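/- Let $G$ be a compact (Hausdorff) group with normalised (regular Borel) Haar measure $\lambda$, let $L^2(G)$ be the space of square-integrable complex functions on $G$, and let $(\tau(g)f)(x)=f(g^{-1}x)$ be the left regular representation. Let $\widehat G$ be the set of isomorphism classes of finite-dimensional continuous irreducible unitary representations of $G$, choose a representative $\pi:G\to U(V_\pi)$ of every class, and put $d_\pi=\dim V_\pi$. For $f\in L^2(G)$ put $$\widehat f(\pi)=\int_G f(g)\,\pi(g)\,d\lambda(g)\in\operatorname{End}(V_\pi).$$ Identify $V_\pi\otimes V_\pi^*$ with $\operatorname{End}(V_\pi)$ by $v\otimes\varphi\mapsto(x\mapsto\varphi(x)v)$. Then the map $U:f\mapsto\bigl(\sqrt{d_\pi}\,\widehat f(\pi)\bigr)_\pi$ is a unitary isomorphism (the Peter–Weyl decomposition) $$U: L^2(G)\;\to\;\bigoplus_{\pi\in\widehat G}V_\pi\otimes V_\pi^*$$ onto the Hilbert space direct sum, and $U\tau(g)U^{-1}=\bigoplus_\pi \pi(g)\otimes I_{V_\pi^*}$ for all $g\in G$. Let $T:L^2(G)\to L^2(G)$ be a bounded linear map with $\tau(g)\circ T=T\circ\tau(g)$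 for all $g\in G$. Then there are $B_\pi\in\operatorname{End}(V_\pi^*)$ and $\widehat k(\pi)\in\operatorname{End}(V_\pi)$, one of each for every $\pi\in\widehat G$, with $B_\pi=\widehat k(\pi)^*$ (the dual map $\varphi\mapsto\varphi\circ\widehat k(\pi)$), such that $T$ is block-diagonal, $$U\,T\,U^{-1}=\bigoplus_{\pi\in\widehat G}I_{V_\pi}\otimes B_\pi ,$$ and, equivalently, acts on Fourier coefficients by right multiplication: for all $f\in L^2(G)$ and all $\pi$, $$\widehat{Tf}(\pi)=\widehat f(\pi)\,\widehat k(\pi).$$ If instead the Fourier coefficients are defined by $\widetilde f(\pi)=\int_G f(g)\,\pi(g)^*\,d\lambda(g)$, the multiplication is from the left: there are $\widetilde k(\pi)\in\operatorname{End}(V_\pi)$ with $\widetilde{Tf}(\pi)=\widetilde k(\pi)\,\widetilde f(\pi)$ for all $f$ and $\pi$. -/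

import Mathlib

open MeasureTheory
open scoped TensorProduct ENNReal

universe u w

namespace CompactFourier

noncomputable section

/-- The dual of a complex Hilbert space is a Hilbert space for the operator norm, with
`⟪φ_v, φ_w⟫ = ⟪w, v⟫` where `φ_v = ⟪v, ·⟫`. -/
instance dualInnerProductSpace (V : Type*) [NormedAddCommGroup V] [InnerProductSpace ℂ V]
    [CompleteSpace V] : InnerProductSpace ℂ (StrongDual ℂ V) where
  inner φ ψ :=
    inner ℂ ((InnerProductSpace.toDual ℂ V).symm ψ) ((InnerProductSpace.toDual ℂ V).symm φ)
  norm_sq_eq_re_inner φ := by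
    rw [← norm_sq_eq_re_inner, LinearIsometryEquiv.norm_map]
  conj_inner_symm φ ψ := inner_conj_symm _ _
  add_left φ ψ χ := by rw [map_add, inner_add_right]
  smul_left φ ψ c := by rw [map_smulₛₗ, inner_smul_right]

/-- The canonical linear map `V ⊗ V* → End V` with `v ⊗ φ ↦ (x ↦ φ x • v)` (an isomorphism when
`V` is finite-dimensional). -/
def tensorToEnd (V : Type*) [NormedAddCommGroup V] [InnerProductSpace ℂ V] [CompleteSpace V] :
    V ⊗[ℂ] StrongDual ℂ V →ₗ[ℂ] (V →L[ℂ] V) :=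
  TensorProduct.lift <| LinearMap.mk₂ ℂ (fun (v : V) (φ : StrongDual ℂ V) => φ.smulRight v)
    (fun v v' φ => by ext; simp) (fun c v φ => by ext; simp [smul_comm _ c])
    (fun v φ φ' => by ext; simp [add_smul]) (fun c v φ => by ext; simp [mul_smul])

/-- The representation by linear maps underlying a homomorphism into a unitary group. -/
def toRepresentation {G : Type*} [Group G] {V : Type*} [NormedAddCommGroup V]
    [InnerProductSpace ℂ V] [CompleteSpace V] (π : G →* unitary (V →L[ℂ] V)) :
    Representation ℂ G V where
  toFun g := ((π g : V →L[ℂ] V) : V →ₗ[ℂ] V)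
  map_one' := by ext; simp
  map_mul' g h := by ext; simp

variable (G : Type u) [Group G] [TopologicalSpace G]

/-- A continuous irreducible unitary representation `π : G → U(V)` on a finite-dimensional complex
Hilbert space. (Completeness of `V` is automatic; irreducible includes `V ≠ 0`.) -/
structure UnitaryIrrep where
  V : Type w
  [normed : NormedAddCommGroup V]
  [innerProduct : InnerProductSpace ℂ V]
  [complete : CompleteSpace V]
  [finiteDim : FiniteDimensional ℂ V]
  π : G →* unitary (V →L[ℂ] V)
  continuous_π : Continuous π
  irreducible : (toRepresentation π).IsIrreducible

attribute [instance] UnitaryIrrep.normed UnitaryIrrep.innerProduct UnitaryIrrep.complete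
  UnitaryIrrep.finiteDim

/-- Isomorphism of unitary representations, through a unitary intertwiner. -/
instance unitaryIrrepSetoid : Setoid (UnitaryIrrep.{u, w} G) where
  r ρ σ := ∃ U : ρ.V ≃ₗᵢ[ℂ] σ.V, ∀ (g : G) (v : ρ.V),
    U ((ρ.π g : ρ.V →L[ℂ] ρ.V) v) = (σ.π g : σ.V →L[ℂ] σ.V) (U v)
  iseqv :=
    { refl := fun ρ => ⟨LinearIsometryEquiv.refl ℂ ρ.V, fun _ _ => rfl⟩
      symm := fun ⟨U, hU⟩ => ⟨U.symm, fun g v => by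
        rw [LinearIsometryEquiv.symm_apply_eq, hU, LinearIsometryEquiv.apply_symm_apply]⟩
      trans := fun ⟨U, hU⟩ ⟨W, hW⟩ => ⟨U.trans W, fun g v => by
        simp only [LinearIsometryEquiv.trans_apply, hU, hW]⟩ }

/-- The unitary dual: isomorphism classes of finite-dimensional irreducible unitary
representations. -/
abbrev UnitaryDual := Quotient (unitaryIrrepSetoid.{u, w} G)

variable {G}
variable [MeasurableSpace G]

/-- The Fourier coefficient `f̂(π) = ∫ f(g) π(g) dμ(g)`. -/
def groupFourier (μ : Measure G) (f : Lp ℂ 2 μ) (ρ : UnitaryIrrep.{u, w} G) : ρ.V →L[ℂ] ρ.V :=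
  ∫ g, f g • (ρ.π g : ρ.V →L[ℂ] ρ.V) ∂μ

/-- The Fourier coefficient `f̃(π) = ∫ f(g) π(g)* dμ(g)`. -/
def groupFourierStar (μ : Measure G) (f : Lp ℂ 2 μ) (ρ : UnitaryIrrep.{u, w} G) : ρ.V →L[ℂ] ρ.V :=
  ∫ g, f g • ContinuousLinearMap.adjoint (ρ.π g : ρ.V →L[ℂ] ρ.V) ∂μ

/-- The left regular representation `(τ(g) f)(x) = f(g⁻¹ x)` on `L²(G)`. -/
def leftRegular [IsTopologicalGroup G] [BorelSpace G] (μ : Measure G) [μ.IsHaarMeasure] (g : G) :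
    Lp ℂ 2 μ →ₗᵢ[ℂ] Lp ℂ 2 μ :=
  Lp.compMeasurePreservingₗᵢ ℂ (fun x => g⁻¹ * x) (measurePreserving_mul_left μ g⁻¹)

/-- The Hilbert space direct sum `⨁_π V_π ⊗ V_π*` over the unitary dual, for a choice `rep` of a
representative of each class. -/
abbrev PeterWeylSum (rep : UnitaryDual.{u, w} G → UnitaryIrrep.{u, w} G) :=
  lp (fun c : UnitaryDual.{u, w} G => (rep c).V ⊗[ℂ] StrongDual ℂ (rep c).V) 2

end

end CompactFourier

open CompactFourier

/-! The map `coeffMap` sends `v ⊗ φ` to `√d` times the matrix coefficient `g ↦ φ (π(g)* v)`. Schur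
orthogonality makes it an isometry of `V ⊗ V*` into `L²(G)` and makes the images for inequivalent
representations orthogonal. Its adjoint is `f ↦ √d f̂(π)`, so once the coefficients are known to be
dense, the Hilbert sum isomorphism they define is the required `U`.

Density (`topologicalClosure_coeffSpan`) comes from right convolutions by continuous kernels `k`
with `k(g⁻¹) = conj k(g)`. These are compact, self-adjoint and commute with left translation. Their
eigenspaces for nonzero eigenvalues are finite-dimensional, invariant and made of continuous
functions, hence of matrix coefficients. By the spectral theorem, a function orthogonal to all
coefficients is killed by every such convolution, which forces it to be zero.

For an operator `T` commuting with translations, `t ↦ (T (coeffMap t))^(ρ)` intertwines the left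
actions of `G`, hence also the left actions of Fourier coefficients `â`. If `â` is `1` at `ρ` and
`0` at `σ`, this kills the contribution of the block of `σ`. On the block of `ρ` itself, a
left-linear map of `End V` is right multiplication by a multiple of its value at `1`. This is
`exists_groupFourier_apply_eq_comp`; density extends it to all of `L²(G)`. The version with `π(g)*`
follows by complex conjugation and taking adjoints. -/

namespace CompactFourier

noncomputable section

/-! ### Compactness of operators with a continuous kernel. -/

section KernelOperator

variable {X H : Type*} [TopologicalSpace X] [CompactSpace X] [NormedAddCommGroup H]
  [InnerProductSpace ℂ H]

/-- The operator `f ↦ (x ↦ ⟪κ x, f⟫)` with values in continuous functions. -/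
def kernelOp (κ : C(X, H)) : H →L[ℂ] C(X, ℂ) :=
  LinearMap.mkContinuous
    { toFun := fun f => ⟨fun x => inner ℂ (κ x) f, by fun_prop⟩
      map_add' := fun f g => by ext; simp
      map_smul' := fun c f => by ext; simp } ‖κ‖ (fun f => by
    rw [ContinuousMap.norm_le _ (by positivity)]
    intro x
    exact (norm_inner_le_norm _ _).trans (by gcongr; exact κ.norm_coe_le_norm x))

/-- Arzelà–Ascoli: by Cauchy–Schwarz the image of the unit ball is bounded by `‖κ‖` and inherits a
common modulus of continuity from `κ`. -/
lemma isCompactOperator_kernelOp (κ : C(X, H)) : IsCompactOperator (kernelOp κ) := by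
  let e : C(X, ℂ) ≃ₜ BoundedContinuousFunction X ℂ :=
    (ContinuousMap.isometryEquivBoundedOfCompact X ℂ).toHomeomorph
  refine (isCompactOperator_iff_image_closedBall_subset_compact
    (kernelOp κ).toLinearMap one_pos).2
    ⟨_, (BoundedContinuousFunction.arzela_ascoli (Metric.closedBall (0 : ℂ) ‖κ‖)
      (isCompact_closedBall _ _)
      ((e ∘ kernelOp κ) '' Metric.closedBall 0 1) ?_ ?_).image e.symm.continuous, ?_⟩
  · rintro _ x ⟨f, hf, rfl⟩
    rw [mem_closedBall_zero_iff] at hf ⊢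
    calc ‖inner ℂ (κ x) f‖ ≤ ‖κ x‖ * ‖f‖ := norm_inner_le_norm _ _
      _ ≤ ‖κ‖ * 1 := by gcongr; exact κ.norm_coe_le_norm x
      _ = ‖κ‖ := mul_one _
  · intro x
    rw [Metric.equicontinuousAt_iff_right]
    intro ε hε
    filter_upwards [Metric.continuousAt_iff'.1 κ.continuous.continuousAt ε hε] with y hy
    rintro ⟨_, f, hf, rfl⟩
    rw [mem_closedBall_zero_iff] at hf
    rw [dist_comm, dist_eq_norm]
    change ‖inner ℂ (κ y) f - inner ℂ (κ x) f‖ < ε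
    rw [← inner_sub_left]
    calc ‖inner ℂ (κ y - κ x) f‖ ≤ ‖κ y - κ x‖ * ‖f‖ := norm_inner_le_norm _ _
      _ ≤ ‖κ y - κ x‖ * 1 := by gcongr
      _ < ε := by rwa [mul_one, ← dist_eq_norm]
  · rintro _ ⟨f, hf, rfl⟩
    exact ⟨e (kernelOp κ f), subset_closure ⟨f, hf, rfl⟩, e.symm_apply_apply _⟩

end KernelOperator

/-! ### Right convolution as a compact self-adjoint operator. -/

section Convolution

variable {G : Type u} [Group G] [TopologicalSpace G] [IsTopologicalGroup G] [CompactSpace G]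
  [MeasurableSpace G] [BorelSpace G] (μ : Measure G) [IsFiniteMeasure μ]

/-- The kernel `x ↦ (y ↦ conj (k (y⁻¹ * x)))` of right convolution by `k`. -/
def convKernel (k : C(G, ℂ)) : C(G, Lp ℂ 2 μ) :=
  ((ContinuousMap.toLp 2 μ ℂ : C(G, ℂ) →L[ℂ] Lp ℂ 2 μ) : C(C(G, ℂ), Lp ℂ 2 μ)).comp
    (ContinuousMap.curry ⟨fun p : G × G => star (k (p.2⁻¹ * p.1)), by fun_prop⟩)

/-- Right convolution `f ↦ f * k`, with values in continuous functions. -/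
def convC (k : C(G, ℂ)) : Lp ℂ 2 μ →L[ℂ] C(G, ℂ) := kernelOp (convKernel μ k)

omit [Group G] [IsTopologicalGroup G] in
lemma inner_toLp_left (a : C(G, ℂ)) (f : Lp ℂ 2 μ) :
    inner ℂ (ContinuousMap.toLp 2 μ ℂ a) f = ∫ y, star (a y) * f y ∂μ := by
  rw [L2.inner_def]
  refine integral_congr_ae ?_
  filter_upwards [ContinuousMap.coeFn_toLp (p := 2) (𝕜 := ℂ) μ a] with y hy
  rw [hy]
  simp [mul_comm]

lemma convC_apply (k : C(G, ℂ)) (f : Lp ℂ 2 μ) (x : G) :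
    convC μ k f x = ∫ y, k (y⁻¹ * x) * f y ∂μ := by
  change inner ℂ (ContinuousMap.toLp 2 μ ℂ _) f = _
  rw [inner_toLp_left]
  simp

/-- Right convolution by `k` on `L²`. -/
def convL2 (k : C(G, ℂ)) : Lp ℂ 2 μ →L[ℂ] Lp ℂ 2 μ :=
  ContinuousMap.toLp 2 μ ℂ ∘L convC μ k

lemma isCompactOperator_convL2 (k : C(G, ℂ)) : IsCompactOperator (convL2 μ k) :=
  (isCompactOperator_kernelOp _).clm_comp (ContinuousMap.toLp 2 μ ℂ)

lemma isSymmetric_convL2 [μ.WeaklyRegular] {k : C(G, ℂ)} (hk : ∀ g, k g⁻¹ = star (k g)) :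
    (convL2 μ k : Lp ℂ 2 μ →ₗ[ℂ] Lp ℂ 2 μ).IsSymmetric := by
  have hd := ContinuousMap.toLp_denseRange ℂ μ ℂ (p := 2) (by simp)
  intro f h
  refine hd.induction_on₂ (p := fun f h => inner ℂ (convL2 μ k f) h = inner ℂ f (convL2 μ k h))
    (isClosed_eq (by fun_prop) (by fun_prop)) ?_ f h
  intro a b
  have key : ∀ a : C(G, ℂ), ∀ x, convC μ k (ContinuousMap.toLp 2 μ ℂ a) x
      = ∫ y, k (y⁻¹ * x) * a y ∂μ := fun a x => by
    rw [convC_apply]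
    refine integral_congr_ae ?_
    filter_upwards [ContinuousMap.coeFn_toLp (p := 2) (𝕜 := ℂ) μ a] with y hy
    rw [hy]
  simp only [convL2, ContinuousLinearMap.comp_apply, ContinuousMap.inner_toLp, key]
  calc _ = ∫ x, ∫ y, b x * star (k (y⁻¹ * x) * a y) ∂μ ∂μ := by
        congr with x
        rw [← integral_conj, integral_const_mul]
        rfl
    _ = ∫ y, ∫ x, b x * star (k (y⁻¹ * x) * a y) ∂μ ∂μ :=
        -- Fubini in the form for continuous compactly supported functions: without second
        -- countability the Borel sets of `G × G` may exceed the product σ-algebra.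
        integral_integral_swap_of_hasCompactSupport (by simp only [Function.uncurry_def]; fun_prop)
          (HasCompactSupport.of_compactSpace _)
    _ = _ := by
        congr with y
        rw [← integral_mul_const]
        congr with x
        rw [star_mul, ← hk]
        simp
        ring

/-- No approximate identity is needed: `f * k` is continuous, and its value at `1` is the inner
product of `f` with `y ↦ conj k(y⁻¹)`, which is an arbitrary continuous function. Such functions are
dense in `L²`. -/
lemma eq_zero_of_convC_eq_zero [μ.WeaklyRegular] {f : Lp ℂ 2 μ}
    (h : ∀ k : C(G, ℂ), (∀ g, k g⁻¹ = star (k g)) → convC μ k f = 0) : f = 0 := by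
  have hadd : ∀ k₁ k₂ : C(G, ℂ), convC μ (k₁ + k₂) f = convC μ k₁ f + convC μ k₂ f := by
    intro k₁ k₂
    ext x
    change inner ℂ (ContinuousMap.toLp 2 μ ℂ _) f = inner ℂ (ContinuousMap.toLp 2 μ ℂ _) f +
      inner ℂ (ContinuousMap.toLp 2 μ ℂ _) f
    rw [← inner_add_left, ← map_add]
    congr 2
    ext y
    simp
  have hsmul : ∀ (c : ℂ) (k : C(G, ℂ)), convC μ (c • k) f = c • convC μ k f := by
    intro c k
    ext x
    simp [convC_apply, mul_assoc, integral_const_mul]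
  have hall : ∀ k : C(G, ℂ), convC μ k f = 0 := by
    intro k
    let k' : C(G, ℂ) := ⟨fun g => star (k g⁻¹), by fun_prop⟩
    -- With the involution `k ↦ k'`, this splits `k` into the Hermitian kernels `k + k'` and `i(k -
    -- k')`, to which the hypothesis applies.
    have : k = (1 / 2 : ℂ) • (k + k') + (-Complex.I / 2) • (Complex.I • (k + (-1 : ℂ) • k')) := by
      ext g
      simp [k']
      ring_nf
      simp
      ring
    rw [this, hadd, hsmul, hsmul, h, h]
    · simp
    · intro g
      simp [k']
      ring
    · intro g
      simp [k', add_comm]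
  have hd := ContinuousMap.toLp_denseRange ℂ μ ℂ (p := 2) (by simp)
  refine hd.eq_zero_of_inner_right ℂ ?_
  intro a
  have := DFunLike.congr_fun (hall ⟨fun g => star (a g⁻¹), by fun_prop⟩) 1
  rw [convC_apply] at this
  rw [inner_toLp_left]
  simpa using this

end Convolution

/-! ### Left translation on `L²(G)` and its commutation with right convolution. -/

section Regular

variable {G : Type u} [Group G] [TopologicalSpace G] [IsTopologicalGroup G] [MeasurableSpace G]
  [BorelSpace G] (μ : Measure G) [μ.IsHaarMeasure]

lemma coeFn_leftRegular (g : G) (f : Lp ℂ 2 μ) :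
    leftRegular μ g f =ᵐ[μ] fun x => f (g⁻¹ * x) :=
  Lp.coeFn_compMeasurePreserving f _

lemma leftRegular_mul (g h : G) (f : Lp ℂ 2 μ) :
    leftRegular μ (g * h) f = leftRegular μ g (leftRegular μ h f) := by
  refine Lp.ext ?_
  filter_upwards [coeFn_leftRegular μ (g * h) f, coeFn_leftRegular μ g (leftRegular μ h f),
    (measurePreserving_mul_left μ g⁻¹).quasiMeasurePreserving.ae (coeFn_leftRegular μ h f)]
    with x h1 h2 h3
  rw [h1, h2, h3]
  simp [mul_assoc]

lemma leftRegular_one (f : Lp ℂ 2 μ) : leftRegular μ 1 f = f := by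
  refine Lp.ext ?_
  filter_upwards [coeFn_leftRegular μ 1 f] with x h1
  simp [h1]

variable [CompactSpace G]

lemma leftRegular_toLp (g : G) (a : C(G, ℂ)) :
    leftRegular μ g (ContinuousMap.toLp 2 μ ℂ a) =
      ContinuousMap.toLp 2 μ ℂ (a.comp ⟨fun x => g⁻¹ * x, by fun_prop⟩) := by
  refine Lp.ext ?_
  filter_upwards [coeFn_leftRegular μ g (ContinuousMap.toLp 2 μ ℂ a),
    ContinuousMap.coeFn_toLp (p := 2) (𝕜 := ℂ) μ (a.comp ⟨fun x => g⁻¹ * x, by fun_prop⟩),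
    (measurePreserving_mul_left μ g⁻¹).quasiMeasurePreserving.ae
      (ContinuousMap.coeFn_toLp (p := 2) (𝕜 := ℂ) μ a)] with x h1 h2 h3
  rw [h1, h2, h3]
  rfl

lemma convC_leftRegular (k : C(G, ℂ)) (g : G) (f : Lp ℂ 2 μ) (x : G) :
    convC μ k (leftRegular μ g f) x = convC μ k f (g⁻¹ * x) := by
  rw [convC_apply, convC_apply,
    ← integral_mul_left_eq_self (μ := μ) (fun y => k (y⁻¹ * (g⁻¹ * x)) * f y) g⁻¹]
  refine integral_congr_ae ?_
  filter_upwards [coeFn_leftRegular μ g f] with y hy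
  simp only [hy]
  congr 2
  group

lemma convL2_leftRegular (k : C(G, ℂ)) (g : G) (f : Lp ℂ 2 μ) :
    convL2 μ k (leftRegular μ g f) = leftRegular μ g (convL2 μ k f) := by
  simp only [convL2, ContinuousLinearMap.comp_apply, leftRegular_toLp]
  congr 1
  ext x
  exact convC_leftRegular μ k g f x

/-- Strong continuity on continuous functions suffices, since the eigenfunctions used below are
continuous. -/
lemma continuous_leftRegular_toLp (a : C(G, ℂ)) :
    Continuous fun g => leftRegular μ g (ContinuousMap.toLp 2 μ ℂ a) := by
  simp only [leftRegular_toLp]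
  exact (ContinuousMap.toLp 2 μ ℂ).continuous.comp
    (ContinuousMap.curry ⟨fun p : G × G => a (p.1⁻¹ * p.2), by fun_prop⟩).continuous

end Regular

/-! ### Reduction of inner product identities to pure tensors. -/

section TensorInner

variable {V F V' F' H : Type*} [NormedAddCommGroup V] [InnerProductSpace ℂ V]
  [NormedAddCommGroup F] [InnerProductSpace ℂ F] [NormedAddCommGroup V'] [InnerProductSpace ℂ V']
  [NormedAddCommGroup F'] [InnerProductSpace ℂ F'] [NormedAddCommGroup H] [InnerProductSpace ℂ H]

lemma inner_map_map_of_tmul {J : V ⊗[ℂ] F →ₗ[ℂ] H}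
    (h : ∀ v φ v' φ', inner ℂ (J (v ⊗ₜ φ)) (J (v' ⊗ₜ φ')) = inner ℂ (v ⊗ₜ[ℂ] φ) (v' ⊗ₜ[ℂ] φ'))
    (s t : V ⊗[ℂ] F) : inner ℂ (J s) (J t) = inner ℂ s t := by
  induction s with
  | zero => simp
  | add s s' hs hs' => simp [inner_add_left, hs, hs']
  | tmul v φ =>
    induction t with
    | zero => simp
    | add t t' ht ht' => simp [inner_add_right, ht, ht']
    | tmul v' φ' => exact h v φ v' φ'

lemma inner_map_map_eq_zero_of_tmul {J : V ⊗[ℂ] F →ₗ[ℂ] H} {J' : V' ⊗[ℂ] F' →ₗ[ℂ] H}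
    (h : ∀ v φ v' φ', inner ℂ (J (v ⊗ₜ φ)) (J' (v' ⊗ₜ φ')) = 0)
    (s : V ⊗[ℂ] F) (t : V' ⊗[ℂ] F') : inner ℂ (J s) (J' t) = 0 := by
  induction s with
  | zero => simp
  | add s s' hs hs' => simp [hs, hs']
  | tmul v φ =>
    induction t with
    | zero => simp
    | add t t' ht ht' => simp [ht, ht']
    | tmul v' φ' => exact h v φ v' φ'

lemma inner_eq_of_tmul {x : V ⊗[ℂ] F} {ℓ : V ⊗[ℂ] F →ₗ[ℂ] ℂ}
    (h : ∀ v φ, inner ℂ x (v ⊗ₜ φ) = ℓ (v ⊗ₜ φ)) (s : V ⊗[ℂ] F) : inner ℂ x s = ℓ s := by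
  induction s with
  | zero => simp
  | add s s' hs hs' => simp [inner_add_right, hs, hs']
  | tmul v φ => exact h v φ

lemma eq_zero_of_inner_tmul {s : V ⊗[ℂ] F} (h : ∀ v φ, inner ℂ (v ⊗ₜ φ) s = 0) : s = 0 := by
  rw [← inner_self_eq_zero (𝕜 := ℂ)]
  suffices ∀ t, inner ℂ t s = 0 from this s
  intro t
  induction t with
  | zero => simp
  | add t t' ht ht' => simp [inner_add_left, ht, ht']
  | tmul v φ => exact h v φ

/-- A linear map on a tensor product that preserves inner products of pure tensors is isometric. -/
def isometryOfInnerTmul (J : V ⊗[ℂ] F →ₗ[ℂ] H)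
    (h : ∀ v φ v' φ', inner ℂ (J (v ⊗ₜ φ)) (J (v' ⊗ₜ φ')) = inner ℂ (v ⊗ₜ[ℂ] φ) (v' ⊗ₜ[ℂ] φ')) :
    V ⊗[ℂ] F →ₗᵢ[ℂ] H :=
  J.isometryOfInner (inner_map_map_of_tmul h)

end TensorInner

namespace UnitaryIrrep

/-! ### Schur's lemma for unitary irreducible representations. -/

section Schur

variable {G : Type u} [Group G] [TopologicalSpace G]

/-- The operator `π(g)` of a unitary representation. -/
abbrev op (ρ : UnitaryIrrep.{u, w} G) (g : G) : ρ.V →L[ℂ] ρ.V := ρ.π g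

variable (ρ σ : UnitaryIrrep.{u, w} G)

lemma continuous_op : Continuous ρ.op := continuous_subtype_val.comp ρ.continuous_π

lemma op_mul_apply (g h : G) (v : ρ.V) : ρ.op (g * h) v = ρ.op g (ρ.op h v) := by
  simp [op]

lemma op_mul (g h : G) : ρ.op (g * h) = ρ.op g ∘L ρ.op h := by
  ext; simp [op_mul_apply]

lemma adjoint_op (g : G) : ContinuousLinearMap.adjoint (ρ.op g) = ρ.op g⁻¹ := by
  have h : ContinuousLinearMap.adjoint (ρ.op g) * ρ.op g = 1 := (ρ.π g).2.1
  have h' : ρ.op g * ρ.op g⁻¹ = 1 := by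
    rw [ContinuousLinearMap.mul_def, ← op_mul]
    simp [op]
  rw [← mul_one (ContinuousLinearMap.adjoint _), ← h', ← mul_assoc, h, one_mul]

lemma inner_op_op (g : G) (v v' : ρ.V) : inner ℂ (ρ.op g v) (ρ.op g v') = inner ℂ v v' := by
  rw [← ContinuousLinearMap.adjoint_inner_right, adjoint_op, ← op_mul_apply]
  simp [op]

lemma norm_op_apply (g : G) (v : ρ.V) : ‖ρ.op g v‖ = ‖v‖ := by
  rw [@norm_eq_sqrt_re_inner ℂ, inner_op_op, ← @norm_eq_sqrt_re_inner ℂ]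

lemma norm_op_le (g : G) : ‖ρ.op g‖ ≤ 1 :=
  ContinuousLinearMap.opNorm_le_bound _ zero_le_one fun v => by rw [norm_op_apply, one_mul]

variable {ρ σ}

/-- **Schur's lemma**: self-intertwiners are scalar. -/
lemma exists_eq_smul_one {A : ρ.V →L[ℂ] ρ.V} (hA : ∀ g v, A (ρ.op g v) = ρ.op g (A v)) :
    ∃ c : ℂ, A = c • 1 := by
  have := ρ.irreducible
  obtain ⟨c, hc⟩ := (Representation.IsIrreducible.algebraMap_intertwiningMap_bijective_of_isAlgClosed
    (ρ := toRepresentation ρ.π)).2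
    ((A : ρ.V →ₗ[ℂ] ρ.V).intertwiningMap_of_isIntertwiningMap (toRepresentation ρ.π)
      (toRepresentation ρ.π) hA)
  refine ⟨c, ?_⟩
  ext v
  exact (congrArg (fun T => T.toLinearMap v) hc).symm

/-- **Schur's lemma**: a nonzero intertwiner gives a unitary equivalence. -/
lemma equiv_of_intertwiner {A : ρ.V →L[ℂ] σ.V} (hA : ∀ g v, A (ρ.op g v) = σ.op g (A v))
    (h0 : A ≠ 0) : ρ ≈ σ := by
  have := ρ.irreducible
  have := σ.irreducible
  have hbij : Function.Bijective A := by
    refine (Representation.IsIrreducible.bijective_or_eq_zero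
      ((A : ρ.V →ₗ[ℂ] σ.V).intertwiningMap_of_isIntertwiningMap (toRepresentation ρ.π)
      (toRepresentation σ.π) hA)).resolve_right fun h => h0 ?_
    ext v
    exact congrArg (fun T => T.toLinearMap v) h
  have hA' : ∀ g w, A.adjoint (σ.op g w) = ρ.op g (A.adjoint w) := by
    intro g w
    refine ext_inner_right ℂ fun v => ?_
    rw [A.adjoint_inner_left, ← inner_op_op σ g⁻¹, ← op_mul_apply, ← hA, ← A.adjoint_inner_left,
      ← inner_op_op ρ g, ← op_mul_apply]
    simp [op]
  -- `A* A` is a self-intertwiner, hence a scalar `c`, so `A` scales all norms by the same factor `r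
  -- = √c`; dividing by `r` gives the unitary intertwiner that the equivalence demands.
  obtain ⟨c, hc⟩ := exists_eq_smul_one (ρ := ρ) (A := A.adjoint ∘L A) (fun g v => by simp [hA, hA'])
  have hn : ∀ v, ((‖A v‖ ^ 2 : ℝ) : ℂ) = c * ((‖v‖ ^ 2 : ℝ) : ℂ) := by
    intro v
    have := congrArg (fun T => inner ℂ v (T v)) hc
    simp only [ContinuousLinearMap.comp_apply, ContinuousLinearMap.adjoint_inner_right,
      smul_apply, one_apply_eq_self, inner_smul_right,
      inner_self_eq_norm_sq_to_K] at this
    simpa using this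
  obtain ⟨v, hv⟩ : ∃ v, A v ≠ 0 := by
    by_contra! h
    exact h0 (by ext v; simp [h])
  have hv0 : v ≠ 0 := fun h => hv (by simp [h])
  set r : ℝ := ‖A v‖ / ‖v‖ with hr
  have hr0 : 0 < r := div_pos (norm_pos_iff.2 hv) (norm_pos_iff.2 hv0)
  have hcr : c = ((r ^ 2 : ℝ) : ℂ) := by
    have h1 : ((‖v‖ ^ 2 : ℝ) : ℂ) ≠ 0 := by
      exact_mod_cast pow_ne_zero 2 (norm_ne_zero_iff.2 hv0)
    rw [hr, div_pow, Complex.ofReal_div, hn v, mul_div_cancel_right₀ _ h1]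
  have hn' : ∀ v, ‖A v‖ = r * ‖v‖ := by
    intro v
    have := hn v
    rw [hcr, ← Complex.ofReal_mul, Complex.ofReal_inj, ← mul_pow] at this
    exact (pow_left_inj₀ (by positivity) (by positivity) two_ne_zero).1 this
  let L : ρ.V →ₗᵢ[ℂ] σ.V :=
    { toLinearMap := ((r⁻¹ : ℝ) : ℂ) • (A : ρ.V →ₗ[ℂ] σ.V)
      norm_map' := fun v => by
        simp [norm_smul, hn', abs_of_pos hr0, hr0.ne'] }
  have hL : Function.Surjective L := by
    intro w
    obtain ⟨x, hx⟩ := hbij.2 ((r : ℂ) • w)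
    refine ⟨x, ?_⟩
    change ((r⁻¹ : ℝ) : ℂ) • A x = w
    rw [hx, smul_smul]
    simp [hr0.ne']
  refine ⟨LinearIsometryEquiv.ofSurjective L hL, fun g v => ?_⟩
  change ((r⁻¹ : ℝ) : ℂ) • A (ρ.op g v) = σ.op g (((r⁻¹ : ℝ) : ℂ) • A v)
  rw [hA, map_smul]

end Schur

/-! ### Schur orthogonality relations by averaging. -/

section Orthogonality

variable {G : Type u} [Group G] [TopologicalSpace G] [IsTopologicalGroup G] [CompactSpace G]
  [MeasurableSpace G] [BorelSpace G] (μ : Measure G) (ρ σ : UnitaryIrrep.{u, w} G)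

omit [IsTopologicalGroup G] [CompactSpace G] [MeasurableSpace G] [BorelSpace G] in
lemma continuous_adjoint_op : Continuous fun g => (ρ.op g).adjoint :=
  ContinuousLinearMap.adjoint.continuous.comp ρ.continuous_op

/-- The average `∫ ρ(g) A σ(g)*`. -/
def average (A : σ.V →L[ℂ] ρ.V) : σ.V →L[ℂ] ρ.V := ∫ g, ρ.op g ∘L A ∘L (σ.op g).adjoint ∂μ

variable [μ.IsHaarMeasure]

omit [IsTopologicalGroup G] in
lemma integrable_average (A : σ.V →L[ℂ] ρ.V) :
    Integrable (fun g => ρ.op g ∘L A ∘L (σ.op g).adjoint) μ :=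
  (ρ.continuous_op.clm_comp (continuous_const.clm_comp
    σ.continuous_adjoint_op)).integrable_of_hasCompactSupport (HasCompactSupport.of_compactSpace _)

/-- Invariance of Haar measure under `g ↦ h g`. -/
lemma average_intertwines (A : σ.V →L[ℂ] ρ.V) (h : G) (v : σ.V) :
    average μ ρ σ A (σ.op h v) = ρ.op h (average μ ρ σ A v) := by
  have key : ρ.op h ∘L average μ ρ σ A = average μ ρ σ A ∘L σ.op h := by
    calc ρ.op h ∘L average μ ρ σ A
        = ∫ g, ρ.op h ∘L ρ.op g ∘L A ∘L (σ.op g).adjoint ∂μ :=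
          ((ContinuousLinearMap.compL ℂ σ.V ρ.V ρ.V (ρ.op h)).integral_comp_comm
            (integrable_average μ ρ σ A)).symm
      _ = ∫ g, (ρ.op (h * g) ∘L A ∘L (σ.op (h * g)).adjoint) ∘L σ.op h ∂μ := by
          congr with g x
          simp [adjoint_op, ← op_mul_apply, mul_assoc]
      _ = ∫ g, (ρ.op g ∘L A ∘L (σ.op g).adjoint) ∘L σ.op h ∂μ :=
          integral_mul_left_eq_self
            (fun g => (ρ.op g ∘L A ∘L (σ.op g).adjoint) ∘L σ.op h) h
      _ = average μ ρ σ A ∘L σ.op h :=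
          (((ContinuousLinearMap.compL ℂ σ.V σ.V ρ.V).flip (σ.op h)).integral_comp_comm
            (integrable_average μ ρ σ A))
  exact (congrArg (fun T => T v) key).symm

-- Averaging the rank-one operator `x ↦ ⟪w', x⟫ w` produces exactly the integral of a product of
-- coefficients, so Schur's lemma for the average becomes an orthogonality relation.
omit [IsTopologicalGroup G] in
lemma inner_average (v w : ρ.V) (v' w' : σ.V) :
    inner ℂ v (average μ ρ σ ((innerSL ℂ w').smulRight w) v') =
      ∫ g, inner ℂ v (ρ.op g w) * inner ℂ (σ.op g w') v' ∂μ := by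
  rw [average, ContinuousLinearMap.integral_apply (integrable_average μ ρ σ _)]
  have := ((innerSL ℂ v).integral_comp_comm
    ((integrable_average μ ρ σ ((innerSL ℂ w').smulRight w)).apply_continuousLinearMap v')).symm
  simp only [innerSL_apply_apply] at this
  rw [this]
  congr with g
  simp [ContinuousLinearMap.adjoint_inner_right, inner_smul_right, mul_comm]

/-- **Schur orthogonality** for inequivalent representations. -/
lemma integral_coeff_mul_coeff_of_not_equiv (h : ¬ σ ≈ ρ) (v w : ρ.V) (v' w' : σ.V) :
    ∫ g, inner ℂ v (ρ.op g w) * inner ℂ (σ.op g w') v' ∂μ = 0 := by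
  rw [← inner_average]
  have : average μ ρ σ ((innerSL ℂ w').smulRight w) = 0 := by
    by_contra h0
    exact h (equiv_of_intertwiner (average_intertwines μ ρ σ _) h0)
  simp [this]

/-- **Schur orthogonality** for the coefficients of one representation. -/
lemma finrank_mul_integral_coeff_mul_coeff [IsProbabilityMeasure μ] (v w v' w' : ρ.V) :
    (Module.finrank ℂ ρ.V : ℂ) * ∫ g, inner ℂ v (ρ.op g w) * inner ℂ (ρ.op g w') v' ∂μ =
      inner ℂ v v' * inner ℂ w' w := by
  obtain ⟨c, hc⟩ := exists_eq_smul_one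
    (average_intertwines μ ρ ρ ((innerSL ℂ w').smulRight w))
  have h1 : ∀ v v', ∫ g, inner ℂ v (ρ.op g w) * inner ℂ (ρ.op g w') v' ∂μ = c * inner ℂ v v' := by
    intro v v'
    rw [← inner_average, hc]
    simp
  let b := stdOrthonormalBasis ℂ ρ.V
  -- The scalar is found by taking the trace: averaging preserves it, and the rank-one operator has
  -- trace `⟪w', w⟫`.
  have h2 : (Module.finrank ℂ ρ.V : ℂ) * c = inner ℂ w' w := by
    calc (Module.finrank ℂ ρ.V : ℂ) * c = ∑ i, c * inner ℂ (b i) (b i) := by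
          simp
      _ = ∑ i, ∫ g, inner ℂ (b i) (ρ.op g w) * inner ℂ (ρ.op g w') (b i) ∂μ := by
          simp only [h1]
      _ = ∫ g, ∑ i, inner ℂ (b i) (ρ.op g w) * inner ℂ (ρ.op g w') (b i) ∂μ := by
          rw [integral_finsetSum]
          intro i _
          have := ρ.continuous_op
          exact Continuous.integrable_of_hasCompactSupport (by fun_prop)
            (HasCompactSupport.of_compactSpace _)
      _ = ∫ g, inner ℂ w' w ∂μ := by
          congr with g
          rw [← inner_op_op ρ g w' w, ← b.sum_inner_mul_inner]
          simp only [mul_comm]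
      _ = inner ℂ w' w := by simp
  rw [h1, ← h2]
  ring

end Orthogonality

/-! ### Matrix coefficients as isometric copies of `V ⊗ V*` in `L²(G)`. -/

section Coefficients

variable {G : Type u} [Group G] [TopologicalSpace G] [IsTopologicalGroup G] [CompactSpace G]
  [MeasurableSpace G] [BorelSpace G] (μ : Measure G) (ρ σ : UnitaryIrrep.{u, w} G)

/-- The matrix coefficient `g ↦ φ (π(g)* v)`. -/
def coeff (v : ρ.V) (φ : StrongDual ℂ ρ.V) : C(G, ℂ) :=
  ⟨fun g => φ ((ρ.op g).adjoint v), by have := ρ.continuous_adjoint_op; fun_prop⟩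

/-- The map `V ⊗ V* → L²(G)` sending `v ⊗ φ` to `√d` times its matrix coefficient. -/
def coeffMap [IsFiniteMeasure μ] : ρ.V ⊗[ℂ] StrongDual ℂ ρ.V →ₗ[ℂ] Lp ℂ 2 μ :=
  (Real.sqrt (Module.finrank ℂ ρ.V) : ℂ) • TensorProduct.lift (LinearMap.mk₂ ℂ
    (fun v φ => ContinuousMap.toLp 2 μ ℂ (ρ.coeff v φ))
    (fun v v' φ => by rw [← map_add]; congr 1; ext; simp [coeff])
    (fun c v φ => by rw [← map_smul]; congr 1; ext; simp [coeff])
    (fun v φ φ' => by rw [← map_add]; congr 1; )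
    (fun c v φ => by rw [← map_smul]; congr 1; ))

omit [IsTopologicalGroup G] in
lemma coeffMap_tmul [IsFiniteMeasure μ] (v : ρ.V) (φ : StrongDual ℂ ρ.V) :
    coeffMap μ ρ (v ⊗ₜ φ) = (Real.sqrt (Module.finrank ℂ ρ.V) : ℂ) •
      ContinuousMap.toLp 2 μ ℂ (ρ.coeff v φ) := rfl

omit [IsTopologicalGroup G] [CompactSpace G] [MeasurableSpace G] [BorelSpace G] in
lemma inner_toDual_toDual (v w : ρ.V) :
    inner ℂ (InnerProductSpace.toDual ℂ ρ.V v) (InnerProductSpace.toDual ℂ ρ.V w) =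
      inner ℂ w v := by
  change inner ℂ ((InnerProductSpace.toDual ℂ ρ.V).symm _) ((InnerProductSpace.toDual ℂ ρ.V).symm _)
    = _
  simp

variable [μ.IsHaarMeasure]

/-- The two factors `√d` multiply to the `d` of Schur orthogonality; this fixes the normalisation of
`coeffMap`. -/
lemma inner_coeffMap_coeffMap_tmul [IsProbabilityMeasure μ] (v v' : ρ.V)
    (φ φ' : StrongDual ℂ ρ.V) :
    inner ℂ (coeffMap μ ρ (v ⊗ₜ φ)) (coeffMap μ ρ (v' ⊗ₜ φ')) =
      inner ℂ (v ⊗ₜ[ℂ] φ) (v' ⊗ₜ[ℂ] φ') := by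
  obtain ⟨w, rfl⟩ := (InnerProductSpace.toDual ℂ ρ.V).surjective φ
  obtain ⟨w', rfl⟩ := (InnerProductSpace.toDual ℂ ρ.V).surjective φ'
  rw [TensorProduct.inner_tmul, inner_toDual_toDual, ← finrank_mul_integral_coeff_mul_coeff μ ρ,
    coeffMap_tmul, coeffMap_tmul, inner_smul_left, inner_smul_right, ContinuousMap.inner_toLp,
    ← mul_assoc, Complex.conj_ofReal, ← Complex.ofReal_mul, Real.mul_self_sqrt (by positivity)]
  congr 1
  congr with g
  simp [coeff, ContinuousLinearMap.adjoint_inner_right, mul_comm]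

lemma inner_coeffMap_coeffMap_tmul_of_not_equiv [IsProbabilityMeasure μ] (h : ¬ σ ≈ ρ)
    (v : ρ.V) (v' : σ.V) (φ : StrongDual ℂ ρ.V) (φ' : StrongDual ℂ σ.V) :
    inner ℂ (coeffMap μ ρ (v ⊗ₜ φ)) (coeffMap μ σ (v' ⊗ₜ φ')) = 0 := by
  obtain ⟨w, rfl⟩ := (InnerProductSpace.toDual ℂ ρ.V).surjective φ
  obtain ⟨w', rfl⟩ := (InnerProductSpace.toDual ℂ σ.V).surjective φ'
  rw [coeffMap_tmul, coeffMap_tmul, inner_smul_left, inner_smul_right, ContinuousMap.inner_toLp]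
  convert mul_zero _
  convert mul_zero _
  rw [← integral_coeff_mul_coeff_of_not_equiv μ ρ σ h v w v' w']
  congr with g
  simp [coeff, ContinuousLinearMap.adjoint_inner_right, mul_comm]

lemma inner_coeffMap_coeffMap_of_not_equiv [IsProbabilityMeasure μ] (h : ¬ σ ≈ ρ)
    (s : ρ.V ⊗[ℂ] StrongDual ℂ ρ.V) (t : σ.V ⊗[ℂ] StrongDual ℂ σ.V) :
    inner ℂ (coeffMap μ ρ s) (coeffMap μ σ t) = 0 :=
  inner_map_map_eq_zero_of_tmul (fun v φ v' φ' =>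
    inner_coeffMap_coeffMap_tmul_of_not_equiv μ ρ σ h v v' φ φ') s t

/-- `coeffMap` as an isometry. -/
def coeffIsometry [IsProbabilityMeasure μ] : ρ.V ⊗[ℂ] StrongDual ℂ ρ.V →ₗᵢ[ℂ] Lp ℂ 2 μ :=
  isometryOfInnerTmul (coeffMap μ ρ) (fun v φ v' φ' => inner_coeffMap_coeffMap_tmul μ ρ v v' φ φ')

end Coefficients

end UnitaryIrrep

/-! ### The Fourier coefficient as adjoint of the coefficient map. -/

section Fourier

variable {G : Type u} [Group G] [TopologicalSpace G] [IsTopologicalGroup G] [CompactSpace G]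
  [MeasurableSpace G] [BorelSpace G] (μ : Measure G) [IsFiniteMeasure μ]
  (ρ : UnitaryIrrep.{u, w} G)

omit [IsTopologicalGroup G] [CompactSpace G] in
lemma integrable_smul_op (f : Lp ℂ 2 μ) : Integrable (fun g => f g • ρ.op g) μ := by
  have hf : Integrable f μ := (Lp.memLp f).integrable one_le_two
  refine hf.mono (hf.1.smul ρ.continuous_op.aestronglyMeasurable) (.of_forall fun g => ?_)
  rw [norm_smul]
  exact mul_le_of_le_one_right (norm_nonneg _) (ρ.norm_op_le g)

omit [IsTopologicalGroup G] [CompactSpace G] in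
lemma inner_groupFourier_apply (f : Lp ℂ 2 μ) (v w : ρ.V) :
    inner ℂ v (groupFourier μ f ρ w) = ∫ g, f g * inner ℂ v (ρ.op g w) ∂μ := by
  rw [groupFourier, ContinuousLinearMap.integral_apply (integrable_smul_op μ ρ f)]
  have := ((innerSL ℂ v).integral_comp_comm
    ((integrable_smul_op μ ρ f).apply_continuousLinearMap w)).symm
  simp only [innerSL_apply_apply] at this
  rw [this]
  simp [inner_smul_right]

-- The Hilbert tensor product pairs with operators through matrix entries; this is how every
-- identity between tensors and Fourier coefficients is tested.
omit [IsTopologicalGroup G] [CompactSpace G] [MeasurableSpace G] [BorelSpace G] in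
lemma inner_tmul_toDual (s : ρ.V ⊗[ℂ] StrongDual ℂ ρ.V) (v w : ρ.V) :
    inner ℂ (v ⊗ₜ[ℂ] InnerProductSpace.toDual ℂ ρ.V w) s = inner ℂ v (tensorToEnd ρ.V s w) := by
  refine inner_eq_of_tmul (ℓ := (innerSL ℂ v).toLinearMap ∘ₗ
    (ContinuousLinearMap.apply ℂ ρ.V w).toLinearMap ∘ₗ tensorToEnd ρ.V) (fun v' φ' => ?_) s
  obtain ⟨w', rfl⟩ := (InnerProductSpace.toDual ℂ ρ.V).surjective φ'
  rw [TensorProduct.inner_tmul, UnitaryIrrep.inner_toDual_toDual]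
  simp only [tensorToEnd, LinearMap.comp_apply, ContinuousLinearMap.coe_coe, TensorProduct.lift.tmul,
    LinearMap.mk₂_apply, ContinuousLinearMap.apply_apply, ContinuousLinearMap.smulRight_apply,
    InnerProductSpace.toDual_apply_apply, innerSL_apply_apply]
  exact ((inner_smul_right _ _ _).trans (mul_comm _ _)).symm

omit [IsTopologicalGroup G] in
lemma inner_coeffMap_tmul_toDual (f : Lp ℂ 2 μ) (v w : ρ.V) :
    inner ℂ (ρ.coeffMap μ (v ⊗ₜ InnerProductSpace.toDual ℂ ρ.V w)) f =
      inner ℂ v (((Real.sqrt (Module.finrank ℂ ρ.V) : ℂ) • groupFourier μ f ρ) w) := by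
  rw [UnitaryIrrep.coeffMap_tmul, inner_smul_left, inner_toLp_left, Complex.conj_ofReal,
    smul_apply, inner_smul_right, inner_groupFourier_apply]
  congr 1
  congr with g
  simp [UnitaryIrrep.coeff, ContinuousLinearMap.adjoint_inner_right, mul_comm]

omit [IsTopologicalGroup G] [CompactSpace G] [MeasurableSpace G] [BorelSpace G] in
lemma tensorToEnd_injective : Function.Injective (tensorToEnd ρ.V) := by
  refine (injective_iff_map_eq_zero (tensorToEnd ρ.V)).2 fun s hs =>
    eq_zero_of_inner_tmul fun v φ => ?_
  obtain ⟨w, rfl⟩ := (InnerProductSpace.toDual ℂ ρ.V).surjective φ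
  simp [inner_tmul_toDual, hs]

omit [IsTopologicalGroup G] in
/-- The adjoint of the coefficient map is the (scaled) Fourier coefficient. -/
lemma tensorToEnd_eq_of_inner {f : Lp ℂ 2 μ} {s : ρ.V ⊗[ℂ] StrongDual ℂ ρ.V}
    (h : ∀ t, inner ℂ t s = inner ℂ (ρ.coeffMap μ t) f) :
    tensorToEnd ρ.V s = (Real.sqrt (Module.finrank ℂ ρ.V) : ℂ) • groupFourier μ f ρ := by
  ext w
  refine ext_inner_left ℂ fun v => ?_
  rw [← inner_tmul_toDual, h, inner_coeffMap_tmul_toDual]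

end Fourier

/-! ### Minimal invariant subspaces and the irreducible representations they carry. -/

lemma exists_minimal_submodule {E : Type*} [AddCommGroup E] [Module ℂ E]
    {P : Submodule ℂ E → Prop} {K : Submodule ℂ E} [FiniteDimensional ℂ K] (hP : P K)
    (hK : K ≠ ⊥) : ∃ W ≤ K, P W ∧ W ≠ ⊥ ∧ ∀ W' ≤ W, P W' → W' = ⊥ ∨ W' = W := by
  obtain ⟨W, ⟨hWK, hPW, hW0⟩, hmin⟩ :=
    (measure fun W : Submodule ℂ E => Module.finrank ℂ W).wf.has_min
      {W | W ≤ K ∧ P W ∧ W ≠ ⊥} ⟨K, le_rfl, hP, hK⟩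
  refine ⟨W, hWK, hPW, hW0, fun W' hW' hPW' => or_iff_not_imp_left.2 fun h0 => ?_⟩
  have := Submodule.finiteDimensional_of_le hWK
  exact Submodule.eq_of_le_of_finrank_le hW'
    (not_lt.1 (hmin W' ⟨hW'.trans hWK, hPW', h0⟩))

section Regular

variable {G : Type u} [Group G] [TopologicalSpace G] [IsTopologicalGroup G]
  [MeasurableSpace G] [BorelSpace G] (μ : Measure G) [μ.IsHaarMeasure]

/-- Invariance of a subspace under left translations. -/
def IsLeftInvariant (W : Submodule ℂ (Lp ℂ 2 μ)) : Prop :=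
  ∀ g, ∀ f ∈ W, leftRegular μ g f ∈ W

variable {μ}

lemma inner_leftRegular_right (g : G) (f h : Lp ℂ 2 μ) :
    inner ℂ f (leftRegular μ g h) = inner ℂ (leftRegular μ g⁻¹ f) h := by
  rw [← (leftRegular μ g).inner_map_map (leftRegular μ g⁻¹ f) h, ← leftRegular_mul,
    mul_inv_cancel, leftRegular_one]

lemma IsLeftInvariant.inf {W W' : Submodule ℂ (Lp ℂ 2 μ)} (hW : IsLeftInvariant μ W)
    (hW' : IsLeftInvariant μ W') : IsLeftInvariant μ (W ⊓ W') :=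
  fun g f hf => ⟨hW g f hf.1, hW' g f hf.2⟩

lemma IsLeftInvariant.orthogonal {W : Submodule ℂ (Lp ℂ 2 μ)} (hW : IsLeftInvariant μ W) :
    IsLeftInvariant μ Wᗮ := fun g f hf h hh => by
  rw [inner_leftRegular_right]
  exact hf _ (hW _ _ hh)

/-- The left regular representation on an invariant subspace. -/
def IsLeftInvariant.isometry {W : Submodule ℂ (Lp ℂ 2 μ)} (hW : IsLeftInvariant μ W) (g : G) :
    W ≃ₗᵢ[ℂ] W where
  toFun f := ⟨leftRegular μ g f, hW g f f.2⟩
  invFun f := ⟨leftRegular μ g⁻¹ f, hW g⁻¹ f f.2⟩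
  map_add' f h := by ext1; simp
  map_smul' c f := by ext1; simp
  left_inv f := by ext1; simp [← leftRegular_mul, leftRegular_one]
  right_inv f := by ext1; simp [← leftRegular_mul, leftRegular_one]
  norm_map' f := (leftRegular μ g).norm_map f

@[simp] lemma IsLeftInvariant.coe_isometry {W : Submodule ℂ (Lp ℂ 2 μ)}
    (hW : IsLeftInvariant μ W) (g : G) (f : W) :
    (hW.isometry g f : Lp ℂ 2 μ) = leftRegular μ g f := rfl

/-- The left regular representation on an invariant subspace, transported along an isometry. -/
def IsLeftInvariant.transport {W : Submodule ℂ (Lp ℂ 2 μ)} (hW : IsLeftInvariant μ W)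
    {V : Type w} [NormedAddCommGroup V] [InnerProductSpace ℂ V] [CompleteSpace V]
    (e : W ≃ₗᵢ[ℂ] V) : G →* unitary (V →L[ℂ] V) :=
  Unitary.linearIsometryEquiv.symm.toMonoidHom.comp
    { toFun := fun g => (e.symm.trans (hW.isometry g)).trans e
      map_one' := by
        ext1 v
        have : hW.isometry 1 (e.symm v) = e.symm v := by ext1; simp [leftRegular_one]
        simp [this]
      map_mul' := fun g h => by
        ext1 v
        have : hW.isometry (g * h) (e.symm v) = hW.isometry g (hW.isometry h (e.symm v)) := by
          ext1; simp [leftRegular_mul]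
        simp [this] }

lemma IsLeftInvariant.transport_apply {W : Submodule ℂ (Lp ℂ 2 μ)} (hW : IsLeftInvariant μ W)
    {V : Type w} [NormedAddCommGroup V] [InnerProductSpace ℂ V] [CompleteSpace V]
    (e : W ≃ₗᵢ[ℂ] V) (g : G) (f : W) :
    (hW.transport e g : V →L[ℂ] V) (e f) = e (hW.isometry g f) := by
  change e (hW.isometry g (e.symm (e f))) = _
  rw [e.symm_apply_apply]

lemma IsLeftInvariant.irreducible_transport {W : Submodule ℂ (Lp ℂ 2 μ)}
    (hW : IsLeftInvariant μ W) (h0 : W ≠ ⊥)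
    (hmin : ∀ W' ≤ W, IsLeftInvariant μ W' → W' = ⊥ ∨ W' = W)
    {V : Type w} [NormedAddCommGroup V] [InnerProductSpace ℂ V] [CompleteSpace V]
    (e : W ≃ₗᵢ[ℂ] V) : (toRepresentation (hW.transport e)).IsIrreducible := by
  have hn : Nontrivial V := by
    have := Submodule.nontrivial_iff_ne_bot.2 h0
    exact e.symm.surjective.nontrivial
  have key : ∀ S : Subrepresentation (toRepresentation (hW.transport e)), S = ⊥ ∨ S = ⊤ := by
    intro S
    have hmem : ∀ f : W, (f : Lp ℂ 2 μ) ∈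
        (S.toSubmodule.comap e.toLinearEquiv.toLinearMap).map W.subtype ↔
          e f ∈ S.toSubmodule := by
      intro f
      constructor
      · rintro ⟨f', hf', hff'⟩
        rwa [← Subtype.ext hff']
      · exact fun h => ⟨f, h, rfl⟩
    -- A subrepresentation of `V`, pulled back along `e`, is an invariant subspace of `W`, so
    -- minimality decides it.
    have hS := hmin _ (Submodule.map_subtype_le W
        (S.toSubmodule.comap e.toLinearEquiv.toLinearMap)) (by
      rintro g _ ⟨f, hf, rfl⟩
      have := S.apply_mem_toSubmodule g hf
      refine (hmem (hW.isometry g f)).2 ?_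
      rw [← hW.transport_apply e]
      exact this)
    refine hS.imp (fun h => ?_) fun h => ?_
    · refine Subrepresentation.toSubmodule_injective ((Submodule.eq_bot_iff _).2 fun v hv => ?_)
      have := (hmem (e.symm v)).2 (by rwa [e.apply_symm_apply])
      rw [h, Submodule.mem_bot, Submodule.coe_eq_zero] at this
      rw [← e.apply_symm_apply v, this, map_zero]
    · refine Subrepresentation.toSubmodule_injective (eq_top_iff.2 fun v _ => ?_)
      have := (hmem (e.symm v)).1 (by rw [h]; exact (e.symm v).2)
      rwa [e.apply_symm_apply] at this
  have : Nontrivial (Subrepresentation (toRepresentation (hW.transport e))) :=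
    ⟨⊥, ⊤, fun h => bot_ne_top (α := Submodule ℂ V) (congrArg Subrepresentation.toSubmodule h)⟩
  exact ⟨key⟩

/-- A minimal finite-dimensional invariant subspace of `L²(G)` on which translation is strongly
continuous is equivalent to a unitary irreducible representation in any universe. -/
lemma exists_unitaryIrrep_of_minimal {W : Submodule ℂ (Lp ℂ 2 μ)} [FiniteDimensional ℂ W]
    (hW : IsLeftInvariant μ W) (hcont : ∀ f ∈ W, Continuous fun g => leftRegular μ g f)
    (h0 : W ≠ ⊥) (hmin : ∀ W' ≤ W, IsLeftInvariant μ W' → W' = ⊥ ∨ W' = W) :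
    ∃ (ρ : UnitaryIrrep.{u, w} G) (e : W ≃ₗᵢ[ℂ] ρ.V),
      ∀ g f, ρ.op g (e f) = e (hW.isometry g f) := by
  -- `W` lives in the universe of `G`; indexing Euclidean space by a lifted `Fin` places the model
  -- in universe `w`.
  let e := ((stdOrthonormalBasis ℂ W).reindex
    (Equiv.ulift.{w} (α := Fin (Module.finrank ℂ W))).symm).repr
  refine ⟨⟨_, hW.transport e, ?_, hW.irreducible_transport h0 hmin e⟩, e, hW.transport_apply e⟩
  refine Continuous.subtype_mk ((continuous_clm_apply (𝕜 := ℂ)).2 fun v => ?_) _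
  exact e.continuous.comp (Continuous.subtype_mk (hcont _ (e.symm v).2) _)

end Regular

/-! ### Density of the matrix coefficients. -/

section Density

variable {G : Type u} [Group G] [TopologicalSpace G] [IsTopologicalGroup G] [CompactSpace G]
  [MeasurableSpace G] [BorelSpace G] (μ : Measure G) [μ.IsHaarMeasure]

lemma leftRegular_coeffMap_tmul (ρ : UnitaryIrrep.{u, w} G) (g : G) (v : ρ.V)
    (φ : StrongDual ℂ ρ.V) :
    leftRegular μ g (ρ.coeffMap μ (v ⊗ₜ φ)) = ρ.coeffMap μ (ρ.op g v ⊗ₜ φ) := by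
  rw [UnitaryIrrep.coeffMap_tmul, UnitaryIrrep.coeffMap_tmul, map_smul, leftRegular_toLp]
  congr 2
  ext x
  simp [UnitaryIrrep.coeff, UnitaryIrrep.adjoint_op, UnitaryIrrep.op_mul_apply]

lemma leftRegular_coeffMap (ρ : UnitaryIrrep.{u, w} G) (g : G)
    (t : ρ.V ⊗[ℂ] StrongDual ℂ ρ.V) :
    leftRegular μ g (ρ.coeffMap μ t) =
      ρ.coeffMap μ (LinearMap.rTensor (StrongDual ℂ ρ.V) (ρ.op g : ρ.V →ₗ[ℂ] ρ.V) t) := by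
  induction t with
  | zero => simp
  | add t t' ht ht' => simp only [map_add, ht, ht']
  | tmul v φ => exact leftRegular_coeffMap_tmul μ ρ g v φ

/-- The span of all matrix coefficients. -/
def coeffSpan : Submodule ℂ (Lp ℂ 2 μ) :=
  ⨆ ρ : UnitaryIrrep.{u, w} G, LinearMap.range (ρ.coeffMap μ)

lemma isLeftInvariant_coeffSpan : IsLeftInvariant μ (coeffSpan.{u, w} μ) := by
  intro g
  change coeffSpan μ ≤ (coeffSpan μ).comap (leftRegular μ g).toLinearMap
  refine iSup_le fun ρ => ?_
  rintro _ ⟨t, rfl⟩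
  change leftRegular μ g _ ∈ coeffSpan μ
  rw [leftRegular_coeffMap]
  exact Submodule.mem_iSup_of_mem ρ ⟨_, rfl⟩

omit [IsTopologicalGroup G] [CompactSpace G] [MeasurableSpace G] [BorelSpace G] in
lemma UnitaryIrrep.finrank_pos (ρ : UnitaryIrrep.{u, w} G) : 0 < Module.finrank ℂ ρ.V := by
  have := ρ.irreducible
  rw [Module.finrank_pos_iff]
  by_contra h
  rw [not_nontrivial_iff_subsingleton] at h
  exact bot_ne_top (α := Subrepresentation (toRepresentation ρ.π))
    (Subrepresentation.toSubmodule_injective (Subsingleton.elim _ _))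

omit [IsTopologicalGroup G] [CompactSpace G] [MeasurableSpace G] [BorelSpace G] in
lemma UnitaryIrrep.sqrt_finrank_ne_zero (ρ : UnitaryIrrep.{u, w} G) :
    (Real.sqrt (Module.finrank ℂ ρ.V) : ℂ) ≠ 0 := by
  have : (0 : ℝ) < Module.finrank ℂ ρ.V := by exact_mod_cast ρ.finrank_pos
  exact_mod_cast (Real.sqrt_pos.2 this).ne'

/-- A minimal invariant subspace of the part of the eigenspace orthogonal to the coefficients it
contains would itself consist of matrix coefficients, hence be orthogonal to itself. So that part is
zero. -/
lemma eigenspace_convL2_le_coeffSpan (k : C(G, ℂ)) {c : ℂ} (hc : c ≠ 0) :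
    Module.End.eigenspace (convL2 μ k).toLinearMap c ≤ coeffSpan.{u, w} μ := by
  set E := Module.End.eigenspace (convL2 μ k).toLinearMap c with hE
  have hfin : FiniteDimensional ℂ E :=
    ContinuousLinearMap.finite_dimensional_eigenspace (isCompactOperator_convL2 μ k) c hc
  have hEinv : IsLeftInvariant μ E := by
    intro g f hf
    rw [hE, Module.End.mem_eigenspace_iff] at hf ⊢
    change convL2 μ k f = _ at hf
    change convL2 μ k _ = _
    rw [convL2_leftRegular, hf, map_smul]
  set M := coeffSpan.{u, w} μ
  have hK : (E ⊓ M)ᗮ ⊓ E = ⊥ := by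
    by_contra hne
    have hKinv : IsLeftInvariant μ ((E ⊓ M)ᗮ ⊓ E) :=
      ((hEinv.inf (isLeftInvariant_coeffSpan μ)).orthogonal).inf hEinv
    have : FiniteDimensional ℂ ((E ⊓ M)ᗮ ⊓ E : Submodule ℂ (Lp ℂ 2 μ)) :=
      Submodule.finiteDimensional_of_le inf_le_right
    obtain ⟨W, hWK, hW, hW0, hmin⟩ := exists_minimal_submodule (P := IsLeftInvariant μ) hKinv hne
    have : FiniteDimensional ℂ W := Submodule.finiteDimensional_of_le hWK
    -- The eigenvalue equation with `c ≠ 0` gives each `f` in `W` a continuous representative, so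
    -- point evaluation makes sense.
    have hWE : ∀ f ∈ W, f = ContinuousMap.toLp 2 μ ℂ (c⁻¹ • convC μ k f) := by
      intro f hf
      have h1 : convL2 μ k f = c • f := Module.End.mem_eigenspace_iff.1 (hWK hf).2
      rw [map_smul, eq_inv_smul_iff₀ hc]
      exact h1.symm
    obtain ⟨ρ, e, he⟩ := exists_unitaryIrrep_of_minimal.{u, w} hW (fun f hf => by
      rw [hWE f hf]; exact continuous_leftRegular_toLp μ _) hW0 hmin
    -- Evaluation at the identity. Since `f(x) = (τ(x⁻¹) f)(1)`, the function `f` is the coefficient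
    -- of `e f` and `φ`.
    let φ : StrongDual ℂ ρ.V := LinearMap.toContinuousLinearMap
      { toFun := fun v => c⁻¹ * convC μ k (e.symm v) 1
        map_add' := fun v v' => by simp [mul_add]
        map_smul' := fun a v => by simp; ring }
    have hWM : W ≤ M := by
      intro f hf
      refine Submodule.mem_iSup_of_mem ρ
        ⟨(Real.sqrt (Module.finrank ℂ ρ.V) : ℂ)⁻¹ • (e ⟨f, hf⟩ ⊗ₜ φ), ?_⟩
      rw [map_smul, UnitaryIrrep.coeffMap_tmul, inv_smul_smul₀ ρ.sqrt_finrank_ne_zero]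
      nth_rw 2 [hWE f hf]
      congr 1
      ext x
      change c⁻¹ * convC μ k (e.symm ((ρ.op x).adjoint (e ⟨f, hf⟩))) 1 = c⁻¹ * convC μ k f x
      rw [UnitaryIrrep.adjoint_op, he, e.symm_apply_apply, hW.coe_isometry, convC_leftRegular]
      simp
    refine hW0 ((Submodule.eq_bot_iff _).2 fun f hf => ?_)
    rw [← inner_self_eq_zero (𝕜 := ℂ)]
    exact (hWK hf).1 f ⟨(hWK hf).2, hWM hf⟩
  have : FiniteDimensional ℂ (E ⊓ M : Submodule ℂ (Lp ℂ 2 μ)) :=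
    Submodule.finiteDimensional_of_le inf_le_left
  have := Submodule.sup_orthogonal_inf_of_hasOrthogonalProjection
    (inf_le_left : E ⊓ M ≤ E)
  rw [hK, sup_bot_eq] at this
  exact inf_eq_left.1 this

/-- **Peter–Weyl**: matrix coefficients span a dense subspace of `L²(G)`. -/
theorem topologicalClosure_coeffSpan [μ.WeaklyRegular] :
    (coeffSpan.{u, w} μ).topologicalClosure = ⊤ := by
  rw [Submodule.topologicalClosure_eq_top_iff, Submodule.eq_bot_iff]
  intro f hf
  refine eq_zero_of_convC_eq_zero μ fun k hk => ?_
  have hsymm := isSymmetric_convL2 μ hk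
  refine ContinuousMap.toLp_injective (p := 2) (𝕜 := ℂ) μ ?_
  rw [map_zero]
  change convL2 μ k f = 0
  -- By the spectral theorem it is enough that `convL2 μ k f` be orthogonal to every eigenspace: for
  -- eigenvalue `0` this is symmetry, and otherwise the eigenvectors lie in `coeffSpan`.
  rw [← Submodule.mem_bot ℂ, ← ContinuousLinearMap.orthogonalComplement_iSup_eigenspaces_eq_bot
    (isCompactOperator_convL2 μ k) hsymm, ← Submodule.iInf_orthogonal, Submodule.mem_iInf]
  intro c y hy
  have hy' : convL2 μ k y = c • y := Module.End.mem_eigenspace_iff.1 hy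
  refine (hsymm y f).symm.trans ?_
  change inner ℂ (convL2 μ k y) f = 0
  rw [hy', inner_smul_left]
  by_cases hc : c = 0
  · simp [hc]
  · rw [hf y (eigenspace_convL2_le_coeffSpan μ k hc hy), mul_zero]

end Density

/-! ### Operators on either tensor factor as left and right multiplication. -/

section TensorToEnd

variable {V : Type*} [NormedAddCommGroup V] [InnerProductSpace ℂ V] [CompleteSpace V]

lemma tensorToEnd_tmul (v : V) (φ : StrongDual ℂ V) :
    tensorToEnd V (v ⊗ₜ φ) = φ.smulRight v := rfl

lemma tensorToEnd_rTensor (A : V →L[ℂ] V) (s : V ⊗[ℂ] StrongDual ℂ V) :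
    tensorToEnd V (LinearMap.rTensor (StrongDual ℂ V) (A : V →ₗ[ℂ] V) s) =
      A ∘L tensorToEnd V s := by
  induction s with
  | zero => simp
  | add s s' hs hs' => simp only [map_add, hs, hs', ContinuousLinearMap.comp_add]
  | tmul v φ =>
    ext x
    simp [tensorToEnd_tmul]

lemma tensorToEnd_lTensor {B : StrongDual ℂ V →ₗ[ℂ] StrongDual ℂ V} {k : V →L[ℂ] V}
    (hB : ∀ φ, B φ = φ ∘L k) (s : V ⊗[ℂ] StrongDual ℂ V) :
    tensorToEnd V (LinearMap.lTensor V B s) = tensorToEnd V s ∘L k := by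
  induction s with
  | zero => simp
  | add s s' hs hs' => simp only [map_add, hs, hs', ContinuousLinearMap.add_comp]
  | tmul v φ =>
    ext x
    simp [tensorToEnd_tmul, hB]

lemma tensorToEnd_surjective [FiniteDimensional ℂ V] : Function.Surjective (tensorToEnd V) := by
  intro A
  let b := stdOrthonormalBasis ℂ V
  refine ⟨∑ i, A (b i) ⊗ₜ InnerProductSpace.toDual ℂ V (b i), ?_⟩
  ext x
  conv_rhs => rw [← b.sum_repr' x]
  simp [tensorToEnd_tmul]

end TensorToEnd

/-! ### Translation-invariant operators on Fourier coefficients. -/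

section FourierLinear

variable {G : Type u} [Group G] [TopologicalSpace G] [IsTopologicalGroup G] [CompactSpace G]
  [MeasurableSpace G] [BorelSpace G] (μ : Measure G) [μ.IsHaarMeasure]
  (ρ σ : UnitaryIrrep.{u, w} G)

omit [IsTopologicalGroup G] in
lemma inner_groupFourier (f : Lp ℂ 2 μ) (v w : ρ.V) :
    inner ℂ v (groupFourier μ f ρ w) = (Real.sqrt (Module.finrank ℂ ρ.V) : ℂ)⁻¹ *
      inner ℂ (ρ.coeffMap μ (v ⊗ₜ InnerProductSpace.toDual ℂ ρ.V w)) f := by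
  rw [inner_coeffMap_tmul_toDual, smul_apply, inner_smul_right,
    inv_mul_cancel_left₀ ρ.sqrt_finrank_ne_zero]

/-- The Fourier transform at `ρ` as a linear map. -/
def groupFourierₗ : Lp ℂ 2 μ →ₗ[ℂ] (ρ.V →L[ℂ] ρ.V) where
  toFun f := groupFourier μ f ρ
  map_add' f f' := by
    ext w
    refine ext_inner_left ℂ fun v => ?_
    simp only [add_apply, inner_add_right, inner_groupFourier, mul_add]
  map_smul' c f := by
    ext w
    refine ext_inner_left ℂ fun v => ?_
    simp only [smul_apply, inner_smul_right, inner_groupFourier, RingHom.id_apply]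
    ring

lemma groupFourier_leftRegular (g : G) (f : Lp ℂ 2 μ) :
    groupFourier μ (leftRegular μ g f) ρ = ρ.op g ∘L groupFourier μ f ρ := by
  have h := (ContinuousLinearMap.compL ℂ ρ.V ρ.V ρ.V (ρ.op g)).integral_comp_comm
    (integrable_smul_op μ ρ f)
  refine Eq.trans ?_ h
  rw [groupFourier, ← integral_mul_left_eq_self (μ := μ)
    (fun x => ContinuousLinearMap.compL ℂ ρ.V ρ.V ρ.V (ρ.op g) (f x • ρ.op x)) g⁻¹]
  refine integral_congr_ae ?_
  filter_upwards [coeFn_leftRegular μ g f] with x hx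
  rw [hx]
  ext v
  simp [← UnitaryIrrep.op_mul_apply]

variable {ρ σ}

-- Integrating the equivariance of `S` against `a` extends it from group elements to the operators
-- `â`, which can be prescribed freely.
omit [IsTopologicalGroup G] in
lemma leftRegular_intertwiner_groupFourier
    {S : σ.V ⊗[ℂ] StrongDual ℂ σ.V →ₗ[ℂ] (ρ.V →L[ℂ] ρ.V)}
    (hS : ∀ g t, S (LinearMap.rTensor (StrongDual ℂ σ.V) (σ.op g : σ.V →ₗ[ℂ] σ.V) t) =
      ρ.op g ∘L S t) (a : Lp ℂ 2 μ) (t : σ.V ⊗[ℂ] StrongDual ℂ σ.V) :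
    S (LinearMap.rTensor (StrongDual ℂ σ.V) (groupFourier μ a σ : σ.V →ₗ[ℂ] σ.V) t) =
      groupFourier μ a ρ ∘L S t := by
  let L : (σ.V →L[ℂ] σ.V) →L[ℂ] (ρ.V →L[ℂ] ρ.V) := LinearMap.toContinuousLinearMap
    { toFun := fun A => S (LinearMap.rTensor (StrongDual ℂ σ.V) (A : σ.V →ₗ[ℂ] σ.V) t)
      map_add' := fun A A' => by
        simp only [ContinuousLinearMap.toLinearMap_add, LinearMap.rTensor_add, LinearMap.add_apply,
          map_add]
      map_smul' := fun c A => by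
        simp only [ContinuousLinearMap.toLinearMap_smul, LinearMap.rTensor_smul,
          LinearMap.smul_apply, map_smul, RingHom.id_apply] }
  change L (groupFourier μ a σ) = _
  rw [groupFourier, ← L.integral_comp_comm (integrable_smul_op μ σ a)]
  have h := ((ContinuousLinearMap.compL ℂ ρ.V ρ.V ρ.V).flip (S t)).integral_comp_comm
    (integrable_smul_op μ ρ a)
  refine Eq.trans ?_ h
  congr with g : 1
  rw [map_smul, map_smul]
  congr 1
  exact hS g t

variable [IsProbabilityMeasure μ]

lemma sqrt_smul_groupFourier_coeffMap (t : ρ.V ⊗[ℂ] StrongDual ℂ ρ.V) :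
    (Real.sqrt (Module.finrank ℂ ρ.V) : ℂ) • groupFourier μ (ρ.coeffMap μ t) ρ =
      tensorToEnd ρ.V t :=
  (tensorToEnd_eq_of_inner μ ρ fun s =>
    (inner_map_map_of_tmul (fun v φ v' φ' =>
      UnitaryIrrep.inner_coeffMap_coeffMap_tmul μ ρ v v' φ φ') s t).symm).symm

lemma groupFourier_coeffMap_of_not_equiv (h : ¬ σ ≈ ρ) (t : σ.V ⊗[ℂ] StrongDual ℂ σ.V) :
    groupFourier μ (σ.coeffMap μ t) ρ = 0 := by
  ext w
  refine ext_inner_left ℂ fun v => ?_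
  rw [inner_groupFourier, UnitaryIrrep.inner_coeffMap_coeffMap_of_not_equiv μ ρ σ h]
  simp

/-- A suitable coefficient function of `ρ` has any prescribed operator as its Fourier coefficient at
`ρ`, and orthogonality makes it invisible at inequivalent representations. -/
lemma exists_groupFourier_eq (A : ρ.V →L[ℂ] ρ.V) :
    ∃ a : Lp ℂ 2 μ, groupFourier μ a ρ = A ∧
      ∀ σ : UnitaryIrrep.{u, w} G, ¬ ρ ≈ σ → groupFourier μ a σ = 0 := by
  obtain ⟨t, ht⟩ := tensorToEnd_surjective ((Real.sqrt (Module.finrank ℂ ρ.V) : ℂ) • A)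
  refine ⟨ρ.coeffMap μ t, ?_, fun σ h => groupFourier_coeffMap_of_not_equiv μ h t⟩
  rw [← sqrt_smul_groupFourier_coeffMap μ] at ht
  exact smul_right_injective _ ρ.sqrt_finrank_ne_zero ht

-- Needed because `coeffSpan` runs over all representations, whereas the direct sum uses one
-- representative per class.
omit [IsTopologicalGroup G] [μ.IsHaarMeasure] in
lemma range_coeffMap_le_of_equiv (h : ρ ≈ σ) :
    LinearMap.range (ρ.coeffMap μ) ≤ LinearMap.range (σ.coeffMap μ) := by
  obtain ⟨U, hU⟩ := h
  have hd : Module.finrank ℂ ρ.V = Module.finrank ℂ σ.V := U.toLinearEquiv.finrank_eq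
  rintro _ ⟨t, rfl⟩
  induction t with
  | zero => rw [map_zero]; exact zero_mem _
  | add t t' ht ht' => rw [map_add]; exact add_mem ht ht'
  | tmul v φ =>
    refine ⟨U v ⊗ₜ (φ ∘L (U.symm : σ.V →L[ℂ] ρ.V)), ?_⟩
    rw [UnitaryIrrep.coeffMap_tmul, UnitaryIrrep.coeffMap_tmul, hd]
    congr 2
    ext g
    have : U.symm (σ.op g⁻¹ (U v)) = ρ.op g⁻¹ v := by
      rw [U.symm_apply_eq]; exact (hU _ _).symm
    simp [UnitaryIrrep.coeff, UnitaryIrrep.adjoint_op, this]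

/-- An operator commuting with left translations acts on Fourier coefficients by right
multiplication. -/
lemma exists_groupFourier_apply_eq_comp [μ.WeaklyRegular] (ρ : UnitaryIrrep.{u, w} G)
    (T : Lp ℂ 2 μ →L[ℂ] Lp ℂ 2 μ) (hT : ∀ g f, leftRegular μ g (T f) = T (leftRegular μ g f)) :
    ∃ k : ρ.V →L[ℂ] ρ.V, ∀ f, groupFourier μ (T f) ρ = groupFourier μ f ρ ∘L k := by
  let S (σ : UnitaryIrrep.{u, w} G) : σ.V ⊗[ℂ] StrongDual ℂ σ.V →ₗ[ℂ] (ρ.V →L[ℂ] ρ.V) :=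
    groupFourierₗ μ ρ ∘ₗ T.toLinearMap ∘ₗ σ.coeffMap μ
  have hS (σ : UnitaryIrrep.{u, w} G) (a : Lp ℂ 2 μ) (t : σ.V ⊗[ℂ] StrongDual ℂ σ.V) :
      S σ (LinearMap.rTensor (StrongDual ℂ σ.V) (groupFourier μ a σ : σ.V →ₗ[ℂ] σ.V) t) =
        groupFourier μ a ρ ∘L S σ t := by
    refine leftRegular_intertwiner_groupFourier μ (fun g t => ?_) a t
    change groupFourier μ (T (σ.coeffMap μ _)) ρ = ρ.op g ∘L groupFourier μ (T (σ.coeffMap μ t)) ρ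
    rw [← leftRegular_coeffMap, ← hT, groupFourier_leftRegular]
  obtain ⟨e, he⟩ := tensorToEnd_surjective (V := ρ.V) 1
  -- The value of the left-linear map `S ρ` at the identity `e`; the factor `√d` turns `tensorToEnd
  -- ρ.V t` into the unscaled Fourier coefficient of `coeffMap t`.
  let k : ρ.V →L[ℂ] ρ.V := (Real.sqrt (Module.finrank ℂ ρ.V) : ℂ) • S ρ e
  have hρ (t : ρ.V ⊗[ℂ] StrongDual ℂ ρ.V) :
      groupFourier μ (T (ρ.coeffMap μ t)) ρ = groupFourier μ (ρ.coeffMap μ t) ρ ∘L k := by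
    obtain ⟨a, ha, -⟩ := exists_groupFourier_eq μ (tensorToEnd ρ.V t)
    have h1 : LinearMap.rTensor (StrongDual ℂ ρ.V) (groupFourier μ a ρ : ρ.V →ₗ[ℂ] ρ.V) e = t := by
      refine tensorToEnd_injective ρ ?_
      rw [tensorToEnd_rTensor, he, ha]
      rfl
    have h2 := hS ρ a e
    rw [h1, ha, ← sqrt_smul_groupFourier_coeffMap μ t] at h2
    refine Eq.trans h2 ?_
    simp [k]
  have hσ (σ : UnitaryIrrep.{u, w} G) (h : ¬ σ ≈ ρ) (t : σ.V ⊗[ℂ] StrongDual ℂ σ.V) :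
      groupFourier μ (T (σ.coeffMap μ t)) ρ = 0 := by
    -- With `â(ρ) = 1` and `â(σ) = 0`, equivariance reads `S σ 0 = S σ t`.
    obtain ⟨a, ha, ha'⟩ := exists_groupFourier_eq μ (1 : ρ.V →L[ℂ] ρ.V)
    have h2 := hS σ a t
    rw [ha' σ (fun h' => h (Setoid.symm h')), ha] at h2
    refine Eq.trans (Eq.trans ?_ h2.symm) ?_
    · rfl
    · simp
  refine ⟨k, fun f => ?_⟩
  ext w
  refine ext_inner_left ℂ fun v => ?_
  rw [ContinuousLinearMap.comp_apply, inner_groupFourier, inner_groupFourier]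
  congr 1
  let x := ρ.coeffMap μ (v ⊗ₜ InnerProductSpace.toDual ℂ ρ.V w)
  let y := ρ.coeffMap μ (v ⊗ₜ InnerProductSpace.toDual ℂ ρ.V (k w))
  -- Each matrix entry of the claim is an equality of two continuous functionals of `f`, so its
  -- solutions form a closed subspace and the dense `coeffSpan` suffices.
  let K : Submodule ℂ (Lp ℂ 2 μ) := (innerSL ℂ x ∘L T - innerSL ℂ y).ker
  have hK (f : Lp ℂ 2 μ) (h : groupFourier μ (T f) ρ = groupFourier μ f ρ ∘L k) : f ∈ K := by
    have := congrArg (fun A => inner ℂ v (A w)) h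
    simp only [ContinuousLinearMap.comp_apply, inner_groupFourier] at this
    have := mul_left_cancel₀ (inv_ne_zero ρ.sqrt_finrank_ne_zero) this
    simpa [K, sub_eq_zero] using this
  have hle : coeffSpan.{u, w} μ ≤ K := by
    refine iSup_le fun σ => ?_
    by_cases h : σ ≈ ρ
    · refine (range_coeffMap_le_of_equiv μ h).trans ?_
      rintro _ ⟨t, rfl⟩
      exact hK _ (hρ t)
    · rintro _ ⟨t, rfl⟩
      refine hK _ ?_
      rw [hσ σ h, groupFourier_coeffMap_of_not_equiv μ h]
      simp
  have hcl : IsClosed (K : Set (Lp ℂ 2 μ)) := ContinuousLinearMap.isClosed_ker _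
  have := Submodule.topologicalClosure_minimal _ hle hcl
  rw [topologicalClosure_coeffSpan] at this
  simpa [K, sub_eq_zero] using this (Submodule.mem_top (x := f))

end FourierLinear

/-! ### Complex conjugation and the second Fourier transform. -/

section Star

variable {α : Type*} [MeasurableSpace α] (μ : Measure α)

lemma star_Lp_add (f g : Lp ℂ 2 μ) : star (f + g) = star f + star g := by
  refine Lp.ext ?_
  filter_upwards [Lp.coeFn_star (f + g), Lp.coeFn_add f g, Lp.coeFn_add (star f) (star g),
    Lp.coeFn_star f, Lp.coeFn_star g] with x h1 h2 h3 h4 h5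
  rw [h1, h3, Pi.star_apply, h2, Pi.add_apply, Pi.add_apply, h4, h5, star_add]
  rfl

lemma star_Lp_smul (c : ℂ) (f : Lp ℂ 2 μ) : star (c • f) = star c • star f := by
  refine Lp.ext ?_
  filter_upwards [Lp.coeFn_star (c • f), Lp.coeFn_smul c f, Lp.coeFn_smul (star c) (star f),
    Lp.coeFn_star f] with x h1 h2 h3 h4
  rw [h1, h3, Pi.star_apply, h2, Pi.smul_apply, Pi.smul_apply, h4, Pi.star_apply, star_smul]

lemma norm_star_Lp (f : Lp ℂ 2 μ) : ‖star f‖ = ‖f‖ := by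
  rw [Lp.norm_def, Lp.norm_def]
  congr 1
  refine eLpNorm_congr_norm_ae ?_
  filter_upwards [Lp.coeFn_star f] with x h
  simp [h]

/-- The conjugate operator `f ↦ conj (T (conj f))`. -/
def conjOperator (T : Lp ℂ 2 μ →L[ℂ] Lp ℂ 2 μ) : Lp ℂ 2 μ →L[ℂ] Lp ℂ 2 μ :=
  LinearMap.mkContinuous
    { toFun := fun f => star (T (star f))
      map_add' := fun f g => by simp [star_Lp_add]
      map_smul' := fun c f => by simp [star_Lp_smul] } ‖T‖ (fun f => by
    change ‖star (T (star f))‖ ≤ _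
    rw [norm_star_Lp, ← norm_star_Lp μ f]
    exact T.le_opNorm _)

lemma conjOperator_star (T : Lp ℂ 2 μ →L[ℂ] Lp ℂ 2 μ) (f : Lp ℂ 2 μ) :
    conjOperator μ T (star f) = star (T f) := by
  change star (T (star (star f))) = _
  rw [star_star]

variable {G : Type u} [Group G] [TopologicalSpace G] [IsTopologicalGroup G]
  [MeasurableSpace G] [BorelSpace G] (ν : Measure G)

lemma leftRegular_star [ν.IsHaarMeasure] (g : G) (f : Lp ℂ 2 ν) :
    leftRegular ν g (star f) = star (leftRegular ν g f) := by
  refine Lp.ext ?_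
  filter_upwards [coeFn_leftRegular ν g (star f), Lp.coeFn_star (leftRegular ν g f),
    coeFn_leftRegular ν g f,
    (measurePreserving_mul_left ν g⁻¹).quasiMeasurePreserving.ae (Lp.coeFn_star f)]
    with x h1 h2 h3 h4
  rw [h1, h2, Pi.star_apply, h3, h4, Pi.star_apply]

-- Taking adjoints conjugates the scalar `f g`; this exchanges the two Fourier conventions, and left
-- with right multiplication.
omit [IsTopologicalGroup G] in
lemma groupFourierStar_eq_adjoint [IsFiniteMeasure ν] (f : Lp ℂ 2 ν) (ρ : UnitaryIrrep.{u, w} G) :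
    groupFourierStar ν f ρ = (groupFourier ν (star f) ρ).adjoint := by
  have hint : Integrable (fun g => f g • (ρ.op g).adjoint) ν := by
    have hf : Integrable f ν := (Lp.memLp f).integrable one_le_two
    refine hf.mono (hf.1.smul ρ.continuous_adjoint_op.aestronglyMeasurable) (.of_forall fun g => ?_)
    rw [norm_smul, ρ.adjoint_op]
    exact mul_le_of_le_one_right (norm_nonneg _) (ρ.norm_op_le _)
  ext w
  refine ext_inner_left ℂ fun v => ?_
  rw [ContinuousLinearMap.adjoint_inner_right,
    ← inner_conj_symm (groupFourier ν (star f) ρ v) w, inner_groupFourier_apply,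
    groupFourierStar, ContinuousLinearMap.integral_apply hint, ← integral_conj]
  have h := ((innerSL ℂ v).integral_comp_comm (hint.apply_continuousLinearMap w)).symm
  refine Eq.trans h (integral_congr_ae ?_)
  filter_upwards [Lp.coeFn_star f] with g hg
  simp [hg, ContinuousLinearMap.adjoint_inner_right]

end Star

/-! ### The Peter–Weyl Hilbert sum. -/

section HilbertSum

/-- Each component of the Hilbert sum isomorphism is the adjoint of the corresponding embedding; for
`coeffIsometry` that adjoint is the scaled Fourier coefficient. -/
lemma inner_linearIsometryEquiv_apply {ι E : Type*} [NormedAddCommGroup E] [InnerProductSpace ℂ E]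
    [CompleteSpace E] {H : ι → Type*} [∀ i, NormedAddCommGroup (H i)]
    [∀ i, InnerProductSpace ℂ (H i)] {V : ∀ i, H i →ₗᵢ[ℂ] E} (hV : IsHilbertSum ℂ H V)
    (i : ι) (t : H i) (f : E) :
    inner ℂ t (hV.linearIsometryEquiv f i) = inner ℂ (V i t) f := by
  classical
  rw [← lp.inner_single_left, ← hV.linearIsometryEquiv_symm_apply_single,
    ← hV.linearIsometryEquiv.inner_map_map, LinearIsometryEquiv.apply_symm_apply]

variable {G : Type u} [Group G] [TopologicalSpace G] [IsTopologicalGroup G] [CompactSpace G]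
  [MeasurableSpace G] [BorelSpace G] (μ : Measure G) [μ.IsHaarMeasure] [IsProbabilityMeasure μ]

/-- The **Peter–Weyl theorem**: `L²(G)` is the Hilbert sum of the spaces of matrix coefficients. -/
theorem isHilbertSum_coeffIsometry [μ.WeaklyRegular]
    (rep : UnitaryDual.{u, w} G → UnitaryIrrep.{u, w} G)
    (hrep : ∀ c, (⟦rep c⟧ : UnitaryDual.{u, w} G) = c) :
    IsHilbertSum ℂ (fun c => (rep c).V ⊗[ℂ] StrongDual ℂ (rep c).V)
      (fun c => (rep c).coeffIsometry μ) := by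
  refine IsHilbertSum.mk ?_ ?_
  · intro c c' hcc' s t
    refine UnitaryIrrep.inner_coeffMap_coeffMap_of_not_equiv μ (rep c) (rep c') (fun h => hcc' ?_)
      s t
    rw [← hrep c, ← hrep c']
    exact (Quotient.sound h).symm
  · rw [← topologicalClosure_coeffSpan.{u, w} μ]
    refine Submodule.topologicalClosure_mono (iSup_le fun ρ => ?_)
    exact (range_coeffMap_le_of_equiv μ (Quotient.exact (hrep ⟦ρ⟧).symm)).trans
      (le_iSup (fun c => LinearMap.range ((rep c).coeffIsometry μ).toLinearMap) ⟦ρ⟧)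

end HilbertSum

end

end CompactFourier

/-! ### The block-diagonal form of translation-invariant operators. -/

theorem theorem3p8 {G : Type u} [Group G] [TopologicalSpace G] [IsTopologicalGroup G]
    [CompactSpace G] [T2Space G] [MeasurableSpace G] [BorelSpace G]
    (μ : Measure G) [μ.IsHaarMeasure] [μ.Regular] [IsProbabilityMeasure μ]
    (rep : UnitaryDual.{u, w} G → UnitaryIrrep.{u, w} G)
    (hrep : ∀ c, (⟦rep c⟧ : UnitaryDual.{u, w} G) = c) :
    -- the Peter–Weyl unitary isomorphism `L²(G) ≅ ⨁ V_π ⊗ V_π*`, pinned by the Fourier transform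
    ∃ U : Lp ℂ 2 μ ≃ₗᵢ[ℂ] PeterWeylSum rep,
      (∀ f c, tensorToEnd (rep c).V (U f c) =
        (Real.sqrt (Module.finrank ℂ (rep c).V) : ℂ) • groupFourier μ f (rep c)) ∧
      -- `τ(g) ≅ ⨁ π(g) ⊗ I`
      (∀ g f c, U (leftRegular μ g f) c =
        LinearMap.rTensor (StrongDual ℂ (rep c).V)
          (((rep c).π g : (rep c).V →L[ℂ] (rep c).V) : (rep c).V →ₗ[ℂ] (rep c).V) (U f c)) ∧
      ∀ T : Lp ℂ 2 μ →L[ℂ] Lp ℂ 2 μ,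
        (∀ g f, leftRegular μ g (T f) = T (leftRegular μ g f)) →
        (∃ (B : ∀ c, StrongDual ℂ (rep c).V →ₗ[ℂ] StrongDual ℂ (rep c).V)
          (k : ∀ c, (rep c).V →L[ℂ] (rep c).V),
          -- `B_π` is the dual map of `k̂(π)`
          (∀ c φ, B c φ = φ ∘L k c) ∧
          -- `T ≅ ⨁ I ⊗ B_π`
          (∀ f c, U (T f) c = LinearMap.lTensor (rep c).V (B c) (U f c)) ∧
          -- right multiplication on Fourier coefficients
          (∀ f c, groupFourier μ (T f) (rep c) =
            groupFourier μ f (rep c) ∘L k c)) ∧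
        -- left multiplication, when `π(g)` is replaced by `π(g)*` in the Fourier transform
        (∃ k : ∀ c, (rep c).V →L[ℂ] (rep c).V,
          ∀ f c, groupFourierStar μ (T f) (rep c) =
            k c ∘L groupFourierStar μ f (rep c)) := by
  have hsum := isHilbertSum_coeffIsometry μ rep hrep
  have hU : ∀ f c, tensorToEnd (rep c).V (hsum.linearIsometryEquiv f c) =
      (Real.sqrt (Module.finrank ℂ (rep c).V) : ℂ) • groupFourier μ f (rep c) := fun f c =>
    tensorToEnd_eq_of_inner μ (rep c) fun t => inner_linearIsometryEquiv_apply hsum c t f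
  refine ⟨hsum.linearIsometryEquiv, hU, fun g f c => tensorToEnd_injective (rep c) ?_,
    fun T hT => ⟨?_, ?_⟩⟩
  · rw [hU, groupFourier_leftRegular, tensorToEnd_rTensor, hU, ContinuousLinearMap.comp_smul]
  · choose k hk using fun c => exists_groupFourier_apply_eq_comp μ (rep c) T hT
    let B (c : UnitaryDual.{u, w} G) :
        StrongDual ℂ (rep c).V →ₗ[ℂ] StrongDual ℂ (rep c).V :=
      { toFun := fun φ => φ ∘L k c
        map_add' := fun φ ψ => ContinuousLinearMap.add_comp _ _ _
        map_smul' := fun a φ => ContinuousLinearMap.smul_comp _ _ _ }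
    refine ⟨B, k, fun _ _ => rfl, fun f c => tensorToEnd_injective (rep c) ?_, fun f c => hk c f⟩
    rw [hU, hk, tensorToEnd_lTensor (k := k c) (fun _ => rfl), hU, ContinuousLinearMap.smul_comp]
  -- Translations commute with conjugation, so the right multiplication result applies to the
  -- conjugate of `T`; its adjoint is the left multiplication sought.
  · have hT' : ∀ g f, leftRegular μ g (conjOperator μ T f) =
        conjOperator μ T (leftRegular μ g f) := fun g f => by
      rw [← star_star f, conjOperator_star, leftRegular_star, leftRegular_star, conjOperator_star,
        hT]
    choose k hk using fun c => exists_groupFourier_apply_eq_comp μ (rep c) _ hT'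
    refine ⟨fun c => (k c).adjoint, fun f c => ?_⟩
    rw [groupFourierStar_eq_adjoint, groupFourierStar_eq_adjoint, ← conjOperator_star, hk,
      ContinuousLinearMap.adjoint_comp]
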